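/- **Lemma B.1 (Gaussian bound).** For every integer $N\ge 1$ let $X_N=(X_N(x))_{x\in\mathbb R^N}$ be a real-valued centered Gaussian process, defined on a probability space that may depend on $N$. Let $\|\cdot\|$ be the Euclidean norm, fix $\rho>0$, let $B_N(0,\rho)$ be the closed Euclidean ball of radius $\rho$ in $\mathbb R^N$, and put $$d_X(x,y)=\mathbb E\big[|X_N(x)-X_N(y)|^2\big]^{1/2},\qquad X_N^*(\rho)=\sup_{x\in B_N(0,\rho)}\frac{|X_N(x)|}{\sqrt N}.$$ Suppose that $$\sup_N\mathbb E[X_N(0)^2]<\infty\qquad\text{and}\qquad \sup_N\ \sup_{x\ne y\in B_N(0,\rho)}\frac{d_X(x,y)}{\|x-y\|}<\infty .$$ Then each $X_N$ has a version whose paths are almost surely continuous on $B_N(0,\rho)$. Moreover, with $X_N^*(\rho)$ computed from any version of $X_N$ that is separable on $B_N(0,\rho)$ (for instance a continuous one), $X_N^*(\rho)$ is measurable up to null sets, and: 1. for every $k\in\mathbb N$, $\ \sup_N\mathbb E[X_N^*(\rho)^k]<\infty$; 2. there is a constant $0<\kappa<\infty$ such that for all $N$ and all $t>0$, $$\mathbb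 P\big[X_N^*(\rho)\ge\kappa+t\big]\le\exp(-Nt^2/\kappa).$$ The bounds in 1 and 2 do not depend on the choice of the separable version. (A process $Y$ is separable on $S\subseteq\mathbb R^N$ if there is a countable $D\subseteq S$ such that almost surely, for all $x\in S$ and $\varepsilon>0$, $Y(x)$ lies in the closure of $\{Y(y): y\in D,\ \|y-x\|<\varepsilon\}$.) **Application to the $p$-linear forms.** Fix an integer $m\ge 1$. For every $N\ge1$ let $\mathbf J=(J_{i_1\cdots i_p})$, $1\le p\le m$, $1\le i_1,\dots,i_p\le N$, be centered Gaussian variables, invariant under permutations of the indices and otherwise independent, where $J_{i_1\cdots i_p}$ has variance $N^{-(p-1)}\prod_k l_k!$ with $(l_k)$ the multiplicities of the distinct elements of the multiset $\{i_1,\dots,i_p\}$. Put $$\|\mathbf J\|_\infty^N=\max_{1\le p\le m}\ \sup_{\|u^1\|,\dots,\|u^p\|\le1}\Big|\frac1{\sqrt N}\sum_{1\le i_1,\dots,i_p\le N}N^{\frac{p-1}2}J_{i_1\cdots i_p}\,u^1_{i_1}\cdots u^p_{i_p}\Big| .$$ Then $\|\mathbf J\|_\infty^N$ is measurable up to null sets,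 $\sup_N\mathbb E[(\|\mathbf J\|_\infty^N)^k]<\infty$ for every $k\in\mathbb N$, and there is a constant $0<\tilde\kappa<\infty$ such that for all $N$ and all $t>0$, $$\mathbb P\big[\|\mathbf J\|_\infty^N\ge\tilde\kappa+t\big]\le m\exp(-Nt^2/\tilde\kappa).$$ -/

import Mathlib

open MeasureTheory ProbabilityTheory
open scoped NNReal ENNReal Nat

noncomputable section

namespace GaussianBound

/-- The metric `d_X(x, y) = 𝔼[|X(x) - X(y)|²]^{1/2}` associated with a process `X`. -/
def processDist {Ω T : Type*} [MeasurableSpace Ω] (P : Measure Ω) (X : T → Ω → ℝ) (x y : T) : ℝ :=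
  √(∫ ω, |X x ω - X y ω| ^ 2 ∂P)

/-- `Y` is a version (modification) of `X`: `Y(x) = X(x)` almost surely, for each fixed `x`. -/
def IsVersion {Ω T : Type*} [MeasurableSpace Ω] (P : Measure Ω) (Y X : T → Ω → ℝ) : Prop :=
  ∀ x, Y x =ᵐ[P] X x

/-- Separability (in the sense of Doob) of the restriction of a process `Y` to an index set `S`:
there is a countable `D ⊆ S` such that, off a null event, for every `x ∈ S` and `ε > 0` the value
`Y(x)` lies in the closure of the set of the values `Y(y)`, `y ∈ D`, `dist y x < ε`.
A process whose paths are almost surely continuous on `S ⊆ ℝ^N` is separable on `S`. -/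
def IsSeparableOn {Ω T : Type*} [MeasurableSpace Ω] [PseudoMetricSpace T] (P : Measure Ω)
    (Y : T → Ω → ℝ) (S : Set T) : Prop :=
  ∃ D : Set T, D ⊆ S ∧ D.Countable ∧
    ∀ᵐ ω ∂P, ∀ x ∈ S, ∀ ε : ℝ, 0 < ε →
      Y x ω ∈ closure ((fun y => Y y ω) '' (D ∩ Metric.ball x ε))

/-- `X_N^*(ρ) = sup_{‖x‖ ≤ ρ} |X_N(x)| / √N`, as an element of `[0, ∞]`. -/
def supNorm {Ω : Type*} (N : ℕ+) (ρ : ℝ) (X : EuclideanSpace ℝ (Fin N) → Ω → ℝ) (ω : Ω) : ℝ≥0∞ :=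
  ⨆ x ∈ Metric.closedBall (0 : EuclideanSpace ℝ (Fin N)) ρ, ENNReal.ofReal (|X x ω| / √(N : ℝ))

/-- The multi-set `{i_1, …, i_p}` of the entries of a tuple of `p` indices. -/
def indexMultiset {N p : ℕ} (i : Fin p → Fin N) : Sym (Fin N) p :=
  Sym.mk (Finset.univ.val.map i) (by simp)

/-- `c({i_1, …, i_p}) = ∏_k l_k!`, with `l_k` the multiplicity of `k` in `{i_1, …, i_p}`. -/
def multFactorial {N p : ℕ} (s : Sym (Fin N) p) : ℕ :=
  ∏ k : Fin N, (Multiset.count k (s : Multiset (Fin N)))!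

/-- The disorder of the system of size `N`, with interactions of the orders `p = 1, …, m` (the order
`p` is written `q + 1` with `q : Fin m`): the couplings `J_{i_1 … i_p} = J_{{i_1, …, i_p}}` are
independent, modulo the permutation of the indices, centered Gaussian variables of variance
`c({i_1, …, i_p}) N^{-(p-1)}`. -/
structure IsDisorder {Ω : Type*} [MeasurableSpace Ω] (P : Measure Ω) (N : ℕ+) (m : ℕ)
    (J : (q : Fin m) → Sym (Fin N) (q + 1) → Ω → ℝ) : Prop where
  hasLaw : ∀ (q : Fin m) (s : Sym (Fin N) (q + 1)),
    HasLaw (J q s) (gaussianReal 0 ((multFactorial s : ℝ≥0) / (N : ℝ≥0) ^ (q : ℕ))) P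
  indep : iIndepFun (fun a : (q : Fin m) × Sym (Fin N) (q + 1) => J a.1 a.2) P

/-- `‖J‖_∞^N`, the maximum over `1 ≤ p ≤ m` and supremum over `‖u^1‖, …, ‖u^p‖ ≤ 1` of
`|N^{-1/2} ∑_{i_1, …, i_p} N^{(p-1)/2} J_{i_1 … i_p} u^1_{i_1} ⋯ u^p_{i_p}|`, in `[0, ∞]`
(here `p = q + 1`). -/
def disorderNorm {Ω : Type*} (N : ℕ+) (m : ℕ)
    (J : (q : Fin m) → Sym (Fin N) (q + 1) → Ω → ℝ) (ω : Ω) : ℝ≥0∞ :=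
  ⨆ q : Fin m, ⨆ u : Fin (q + 1) → EuclideanSpace ℝ (Fin N), ⨆ _ : ∀ j, ‖u j‖ ≤ 1,
    ENNReal.ofReal |(√(N : ℝ))⁻¹ * ∑ i : Fin (q + 1) → Fin N,
      (√(N : ℝ)) ^ (q : ℕ) * J q (indexMultiset i) ω * ∏ j, u j (i j)|

end GaussianBound

end

/-!
The proof is a chaining argument which gives the deviation inequality directly, so that no
isoperimetric inequality is needed.

In dimension `d` the ball of radius `ρ` has nets `T j` of mesh `ρ / 4 ^ j` with at most
`(3 * 4 ^ j) ^ d` points, by comparison of volumes (`exists_isNetSequence`). For a Lipschitz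
Gaussian process `X`, an increment along a link of length of order `4 ^ (-j)` exceeds
`√d (c + s) / 2 ^ j` with probability at most `2 exp (- d 4 ^ j (c + s) ^ 2 / K)`. The number of
links at this scale is itself exponential in `d`, with a rate linear in `j`; hence for a large constant
`c` the union bound costs nothing, and all the links are controlled simultaneously except on
an event of probability at most `exp (- d s ^ 2 / K)`
(`IsSubgaussianField.measure_not_isChainBounded_le`). On the good event the values of `X` along the
nets converge uniformly to a continuous function bounded by `3 √d (c + s)`
(`IsChainBounded.exists_limit`). The limit is a version of `X`
(`IsSubgaussianField.exists_continuous_version`), and a separable version has the same supremum as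
the continuous one over a countable set, which gives the measurability and the tails
(`IsSubgaussianField.scaledSup_tail`). The moments follow by integration of the tails
(`lintegral_pow_le_momentBound`).

The argument uses only the sub-Gaussian moment generating functions of `X 0` and of the increments,
and works in any finite-dimensional normed space. It thus applies to the `p`-linear form of the
disorder on `(ℝ^N)^p`, of dimension `p * N`, with the maximum of the Euclidean norms, for which the
product of the unit balls is the unit ball: its increments are sub-Gaussian with a variance bounded
independently of `N`, since elementary tensors are Lipschitz functions of their factors
(`IsDisorder.isSubgaussianField`).
-/

noncomputable section

namespace GaussianBound
open Metric Filter Topology Module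

/-! ### Nets of balls in finite-dimensional normed spaces -/

section Nets
variable {E : Type*} [NormedAddCommGroup E] [NormedSpace ℝ E] [FiniteDimensional ℝ E]

/-- A volume argument: the balls of radius `δ / 2` around the points are disjoint and contained in
the ball of radius `R + δ / 2`. -/
lemma card_le_of_separated_closedBall {R δ : ℝ} (hR : 0 ≤ R) (hδ : 0 < δ) (s : Finset E)
    (hs : ∀ c ∈ s, ‖c‖ ≤ R) (h : ∀ c ∈ s, ∀ d ∈ s, c ≠ d → δ ≤ ‖c - d‖) :
    (s.card : ℝ) ≤ (1 + 2 * R / δ) ^ finrank ℝ E := by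
  borelize E
  let μ : Measure E := Measure.addHaar
  have hδ2 : 0 < δ / 2 := by positivity
  have hRδ : 0 < R + δ / 2 := by positivity
  have D : Set.Pairwise (s : Set E) (Function.onFun Disjoint fun c => ball (c : E) (δ / 2)) := by
    rintro c hc d hd hcd
    apply ball_disjoint_ball
    rw [dist_eq_norm]
    linarith [h c hc d hd hcd]
  have A_subset : (⋃ c ∈ s, ball (c : E) (δ / 2)) ⊆ ball (0 : E) (R + δ / 2) := by
    refine Set.iUnion₂_subset fun x hx => ball_subset_ball' ?_
    rw [dist_zero_right]
    linarith [hs x hx]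
  have I : (s.card : ℝ≥0∞) * ENNReal.ofReal ((δ / 2) ^ finrank ℝ E) * μ (ball 0 1) ≤
      ENNReal.ofReal ((R + δ / 2) ^ finrank ℝ E) * μ (ball 0 1) :=
    calc
      _ = μ (⋃ c ∈ s, ball (c : E) (δ / 2)) := by
        rw [measure_biUnion_finset D fun c _ => measurableSet_ball]
        simp only [μ.addHaar_ball_of_pos _ hδ2, Finset.sum_const, nsmul_eq_mul, mul_assoc]
      _ ≤ μ (ball (0 : E) (R + δ / 2)) := measure_mono A_subset
      _ = _ := by simp only [μ.addHaar_ball_of_pos _ hRδ]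
  have J := (ENNReal.mul_le_mul_iff_left (measure_ball_pos _ _ zero_lt_one).ne'
    measure_ball_lt_top.ne).1 I
  have K := ENNReal.toReal_le_of_le_ofReal (pow_nonneg hRδ.le _) J
  rw [ENNReal.toReal_mul, ENNReal.toReal_natCast, ENNReal.toReal_ofReal (by positivity)] at K
  have e : (1 + 2 * R / δ) = (R + δ / 2) / (δ / 2) := by
    field_simp
    ring
  rw [e, div_pow, le_div_iff₀ (by positivity)]
  exact K

lemma exists_finset_cover_closedBall {R δ : ℝ} (hR : 0 ≤ R) (hδ : 0 < δ) :
    ∃ T : Finset E, (∀ c ∈ T, ‖c‖ ≤ R) ∧ (T.card : ℝ) ≤ (1 + 2 * R / δ) ^ finrank ℝ E ∧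
      ∀ x : E, ‖x‖ ≤ R → ∃ c ∈ T, ‖x - c‖ ≤ δ := by
  classical
  let ε : ℝ≥0 := ⟨δ, hδ.le⟩
  let A : Set E := closedBall 0 R
  have hpack : packingNumber ε A ≤ (⌊(1 + 2 * R / δ) ^ finrank ℝ E⌋₊ : ℕ∞) := by
    refine iSup₂_le fun C hCA => iSup_le fun hC => ?_
    refine ENat.forall_natCast_le_iff_le.1 fun n hn => ?_
    obtain ⟨D, hDC, hD⟩ := Set.exists_subset_encard_eq hn
    have hfin : D.Finite := Set.finite_of_encard_eq_coe hD
    lift D to Finset E using hfin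
    rw [Set.encard_coe_eq_coe_finsetCard, Nat.cast_inj] at hD
    rw [← hD]
    refine Nat.cast_le.2 (Nat.le_floor (card_le_of_separated_closedBall hR hδ D ?_ ?_))
    · intro c hc
      simpa [A] using hCA (hDC hc)
    · intro c hc d hd hcd
      have : (ε : ℝ≥0∞) < edist c d := hC (hDC hc) (hDC hd) hcd
      rw [edist_dist, dist_eq_norm, ← ENNReal.ofReal_coe_nnreal] at this
      exact (ENNReal.ofReal_lt_ofReal_iff_of_nonneg hδ.le).1 this |>.le
  have hne : packingNumber ε A ≠ ⊤ := ne_top_of_le_ne_top (ENat.natCast_ne_top _) hpack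
  let C := maximalSeparatedSet ε A
  have hCA : C ⊆ A := maximalSeparatedSet_subset
  have hCcover : IsCover ε A C := isCover_maximalSeparatedSet hne
  have hCcard : C.encard ≤ (⌊(1 + 2 * R / δ) ^ finrank ℝ E⌋₊ : ℕ∞) :=
    (encard_maximalSeparatedSet hne).trans_le hpack
  have hCfin : C.Finite := Set.finite_of_encard_le_coe hCcard
  refine ⟨hCfin.toFinset, fun c hc => ?_, ?_, fun x hx => ?_⟩
  · simpa [A] using hCA (hCfin.mem_toFinset.1 hc)
  · rw [hCfin.encard_eq_coe_toFinset_card] at hCcard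
    exact (Nat.le_floor_iff (by positivity)).1 (Nat.cast_le.1 hCcard)
  · obtain ⟨c, hc, hxc⟩ := hCcover (show x ∈ A by simpa [A] using hx)
    refine ⟨c, hCfin.mem_toFinset.2 hc, ?_⟩
    rw [← dist_eq_norm]
    have : edist x c ≤ ε := hxc
    rw [edist_dist, ← ENNReal.ofReal_coe_nnreal] at this
    exact (ENNReal.ofReal_le_ofReal_iff hδ.le).1 this

/-- Nets of the closed ball of radius `ρ` at the scales `ρ / 4 ^ j`: finite sets `T j`, starting
from `T 0 = {0}`, whose cardinality is at most `(3 * 4 ^ j) ^ d` in dimension `d`, together with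
maps `π j` sending each point of the ball to a point of `T j` at distance at most `ρ / 4 ^ j`. -/
structure IsNetSequence (ρ : ℝ) (T : ℕ → Finset E) (π : ℕ → E → E) : Prop where
  zero : T 0 = {0}
  norm_le : ∀ j, ∀ a ∈ T j, ‖a‖ ≤ ρ
  card_le : ∀ j, ((T j).card : ℝ) ≤ (3 * 4 ^ j) ^ finrank ℝ E
  proj_mem : ∀ j x, ‖x‖ ≤ ρ → π j x ∈ T j
  norm_sub_proj : ∀ j x, ‖x‖ ≤ ρ → ‖x - π j x‖ ≤ ρ / 4 ^ j

lemma exists_isNetSequence {ρ : ℝ} (hρ : 0 < ρ) :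
    ∃ (T : ℕ → Finset E) (π : ℕ → E → E), IsNetSequence ρ T π := by
  have key : ∀ j : ℕ, ∃ (T : Finset E) (π : E → E), (j = 0 → T = {0}) ∧ (∀ a ∈ T, ‖a‖ ≤ ρ) ∧
      (T.card : ℝ) ≤ (3 * 4 ^ j) ^ finrank ℝ E ∧ (∀ x, ‖x‖ ≤ ρ → π x ∈ T) ∧
      (∀ x, ‖x‖ ≤ ρ → ‖x - π x‖ ≤ ρ / 4 ^ j) := by
    intro j
    rcases Nat.eq_zero_or_pos j with rfl | hj
    · refine ⟨{0}, fun _ => 0, fun _ => rfl, by simpa using hρ.le, ?_, by simp, by simp⟩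
      simp only [Finset.card_singleton, Nat.cast_one, pow_zero, mul_one]
      exact one_le_pow₀ (by norm_num)
    · obtain ⟨T, h1, h2, h3⟩ := exists_finset_cover_closedBall (E := E) hρ.le
        (show 0 < ρ / 4 ^ j by positivity)
      choose! π hπ using h3
      refine ⟨T, π, fun h => absurd h hj.ne', h1, h2.trans ?_, fun x hx => (hπ x hx).1,
        fun x hx => (hπ x hx).2⟩
      have e : 2 * ρ / (ρ / 4 ^ j) = 2 * 4 ^ j := by field_simp
      rw [e]
      have : (1 : ℝ) ≤ 4 ^ j := one_le_pow₀ (by norm_num)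
      gcongr
      linarith
  choose T π h0 h1 h2 h3 h4 using key
  exact ⟨T, π, h0 0 rfl, h1, h2, h3, h4⟩

end Nets

/-! ### Limits along nets of chain-bounded paths -/

section Chaining
variable {E : Type*} [NormedAddCommGroup E]

/-- The path `f` is smaller than `A` at the origin, and its increments along the links of the nets
`T` at the scale `ρ / 4 ^ j` are at most `A / 2 ^ j`. -/
def IsChainBounded (ρ : ℝ) (T : ℕ → Finset E) (f : E → ℝ) (A : ℝ) : Prop :=
  |f 0| < A ∧ ∀ j, ∀ a ∈ T j, ∀ b ∈ T (j + 1), ‖a - b‖ ≤ 3 * ρ / 4 ^ j → |f a - f b| ≤ A / 2 ^ j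

variable [NormedSpace ℝ E] {ρ : ℝ} {T : ℕ → Finset E} {π : ℕ → E → E} {f : E → ℝ} {A : ℝ}

/-- Nearby points of the ball have projections to consecutive nets which form a link. -/
lemma IsChainBounded.abs_sub_le (hf : IsChainBounded ρ T f A) (hT : IsNetSequence ρ T π)
    (hρ : 0 < ρ) (j : ℕ) {x y : E} (hx : ‖x‖ ≤ ρ) (hy : ‖y‖ ≤ ρ) (hxy : ‖x - y‖ ≤ ρ / 4 ^ j) :
    |f (π j x) - f (π (j + 1) y)| ≤ A / 2 ^ j := by
  refine hf.2 j _ (hT.proj_mem j x hx) _ (hT.proj_mem (j + 1) y hy) ?_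
  have h1 := hT.norm_sub_proj j x hx
  have h2 := hT.norm_sub_proj (j + 1) y hy
  have h3 : ρ / 4 ^ (j + 1) ≤ ρ / 4 ^ j := by
    gcongr
    · norm_num
    · omega
  have e : π j x - π (j + 1) y = (x - y) - (x - π j x) + (y - π (j + 1) y) := by abel
  rw [e, mul_div_assoc]
  linarith [norm_add_le ((x - y) - (x - π j x)) (y - π (j + 1) y),
    norm_sub_le (x - y) (x - π j x)]

/-- A chain-bounded path converges along the nets, uniformly on the ball, and the limit is a
continuous function which is smaller than `3 * A`. -/
lemma IsChainBounded.exists_limit (hf : IsChainBounded ρ T f A) (hT : IsNetSequence ρ T π)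
    (hρ : 0 < ρ) :
    ∃ g : E → ℝ, (∀ x, ‖x‖ ≤ ρ → Tendsto (fun j => f (π j x)) atTop (𝓝 (g x))) ∧
      (∃ b < 3 * A, ∀ x, ‖x‖ ≤ ρ → |g x| ≤ b) ∧ ContinuousOn g (closedBall 0 ρ) := by
  have step : ∀ x, ‖x‖ ≤ ρ → ∀ j, dist (f (π j x)) (f (π (j + 1) x)) ≤ 2 * A / 2 / 2 ^ j := by
    intro x hx j
    rw [Real.dist_eq]
    refine (hf.abs_sub_le hT hρ j hx hx (by simp; positivity)).trans_eq ?_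
    ring
  have hlim : ∀ x, ∃ l, ‖x‖ ≤ ρ → Tendsto (fun j => f (π j x)) atTop (𝓝 l) := by
    intro x
    by_cases hx : ‖x‖ ≤ ρ
    · obtain ⟨l, hl⟩ := cauchySeq_tendsto_of_complete (cauchySeq_of_le_geometric_two (step x hx))
      exact ⟨l, fun _ => hl⟩
    · exact ⟨0, fun h => absurd h hx⟩
  choose g hg using hlim
  have hdist : ∀ x, ‖x‖ ≤ ρ → ∀ j, |f (π j x) - g x| ≤ 2 * A / 2 ^ j := fun x hx j =>
    dist_le_of_le_geometric_two_of_tendsto (step x hx) (hg x hx) j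
  have hA : 0 < A := (abs_nonneg _).trans_lt hf.1
  refine ⟨g, hg, ⟨|f 0| + 2 * A, by linarith [hf.1], fun x hx => ?_⟩, ?_⟩
  · have h0 : π 0 x = 0 := by simpa [hT.zero] using hT.proj_mem 0 x hx
    have := hdist x hx 0
    rw [h0, pow_zero, div_one, abs_sub_comm] at this
    linarith [abs_sub_abs_le_abs_sub (g x) (f 0)]
  · have hclose : ∀ j, ∀ x, ‖x‖ ≤ ρ → ∀ y, ‖y‖ ≤ ρ → ‖x - y‖ ≤ ρ / 4 ^ j →
        |g x - g y| ≤ 5 * A * (1 / 2) ^ j := by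
      intro j x hx y hy hxy
      have h1 := hdist x hx j
      have h2 := hf.abs_sub_le hT hρ j hx hy hxy
      have h3 := hdist y hy (j + 1)
      have h4 : 2 * A / 2 ^ (j + 1) ≤ 2 * A / 2 ^ j := by
        gcongr
        · norm_num
        · omega
      have e : g x - g y = -(f (π j x) - g x) + (f (π j x) - f (π (j + 1) y)) +
        (f (π (j + 1) y) - g y) := by ring
      rw [e]
      have e2 : 5 * A * (1 / 2) ^ j = 2 * A / 2 ^ j + A / 2 ^ j + 2 * A / 2 ^ j := by
        rw [one_div, inv_pow]
        ring
      rw [e2]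
      refine (abs_add_three _ _ _).trans ?_
      rw [abs_neg]
      linarith
    rw [Metric.continuousOn_iff]
    intro x hx ε hε
    have ht : Tendsto (fun j : ℕ => 5 * A * (1 / 2 : ℝ) ^ j) atTop (𝓝 0) := by
      simpa using (tendsto_pow_atTop_nhds_zero_of_lt_one (r := (1 / 2 : ℝ)) (by norm_num)
        (by norm_num)).const_mul (5 * A)
    obtain ⟨j, hj⟩ := (ht.eventually (gt_mem_nhds hε)).exists
    refine ⟨ρ / 4 ^ j, by positivity, fun y hy hyx => ?_⟩
    rw [mem_closedBall_zero_iff] at hx hy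
    rw [dist_eq_norm] at hyx
    exact (hclose j y hy x hx hyx.le).trans_lt hj

end Chaining

/-! ### Tails of sub-Gaussian variables -/

section Subgaussian
variable {Ω : Type*} [MeasurableSpace Ω] {P : Measure Ω}

lemma hasSubgaussianMGF_mono {X : Ω → ℝ} {c c' : ℝ≥0} (h : HasSubgaussianMGF X c P)
    (hc : c ≤ c') : HasSubgaussianMGF X c' P where
  integrable_exp_mul := h.integrable_exp_mul
  mgf_le t := (h.mgf_le t).trans (by gcongr)

lemma measure_le_abs_of_hasSubgaussianMGF [IsFiniteMeasure P] {X : Ω → ℝ} {c : ℝ≥0}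
    (h : HasSubgaussianMGF X c P) {ε : ℝ} (hε : 0 ≤ ε) :
    P {ω | ε ≤ |X ω|} ≤ ENNReal.ofReal (2 * Real.exp (-ε ^ 2 / (2 * c))) := by
  have h1 := h.measure_ge_le hε
  have h2 := h.neg.measure_ge_le hε
  have hsub : {ω | ε ≤ |X ω|} ⊆ {ω | ε ≤ X ω} ∪ {ω | ε ≤ (-X) ω} := fun ω hω =>
    le_abs.1 (show ε ≤ |X ω| from hω)
  refine (measure_mono hsub).trans ?_
  rw [← ofReal_measureReal (measure_ne_top _ _)]
  exact ENNReal.ofReal_le_ofReal ((measureReal_union_le _ _).trans (by linarith))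

/-- A random variable with law `𝒩(0, v)` is sub-Gaussian with variance proxy `v`. -/
lemma hasSubgaussianMGF_of_map_eq_gaussianReal [IsProbabilityMeasure P] {X : Ω → ℝ} {v : ℝ≥0}
    (hX : AEMeasurable X P)
    (h : P.map X = gaussianReal 0 v) : HasSubgaussianMGF X v P where
  integrable_exp_mul t := by
    have := integrable_exp_mul_gaussianReal (μ := 0) (v := v) t
    rw [← h] at this
    exact this.comp_aemeasurable hX
  mgf_le t := by rw [mgf_gaussianReal h]; simp

end Subgaussian

/-! ### The union bound over the links -/

section Field
variable {E : Type*} [NormedAddCommGroup E]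
  {Ω : Type*} [MeasurableSpace Ω]

/-- The random field `X` is sub-Gaussian on the closed ball of radius `ρ`: `X 0` has variance
proxy `v` and the increment `X x - X y` has variance proxy `v * ‖x - y‖ ^ 2`. -/
structure IsSubgaussianField (P : Measure Ω) (X : E → Ω → ℝ) (ρ : ℝ) (v : ℝ≥0) : Prop where
  zero : HasSubgaussianMGF (X 0) v P
  sub : ∀ x y, ‖x‖ ≤ ρ → ‖y‖ ≤ ρ →
    HasSubgaussianMGF (fun ω => X x ω - X y ω) (v * ‖x - y‖₊ ^ 2) P

/-- A positive number bounding `v` and `9 * ρ ^ 2 * v`, hence, after the factor `16 ^ (-j)`, the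
variance proxies of the links of length at most `3 * ρ / 4 ^ j`. -/
def linkVariance (v : ℝ≥0) (ρ : ℝ) : ℝ≥0 := v * (1 + 9 * ρ.toNNReal ^ 2) + 1

/-- The level, divided by `√d`, above which the Gaussian tails of the links compensate the entropy
of the nets. Its square is `7` times `2 * linkVariance v ρ`, where `7` is chosen for
`exp (-7) ≤ 1 / 1000`. -/
def chainLevel (v : ℝ≥0) (ρ : ℝ) : ℝ := √(14 * linkVariance v ρ)

lemma linkVariance_pos (v : ℝ≥0) (ρ : ℝ) : (0 : ℝ) < linkVariance v ρ := by
  have : (0 : ℝ≥0) < linkVariance v ρ := by unfold linkVariance; positivity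
  exact_mod_cast this

lemma chainLevel_sq (v : ℝ≥0) (ρ : ℝ) : chainLevel v ρ ^ 2 = 14 * linkVariance v ρ :=
  Real.sq_sqrt (by positivity)

lemma chainLevel_pos (v : ℝ≥0) (ρ : ℝ) : 0 < chainLevel v ρ :=
  Real.sqrt_pos.2 (by have := linkVariance_pos v ρ; positivity)

lemma exp_neg_seven_le : Real.exp (-7) ≤ 1 / 1000 := by
  have h : (1000 : ℝ) ≤ Real.exp 7 := by
    have h1 : (2.7182818283 : ℝ) < Real.exp 1 := Real.exp_one_gt_d9
    have h2 : Real.exp 7 = Real.exp 1 ^ 7 := by rw [← Real.exp_nat_mul]; norm_num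
    rw [h2]
    calc (1000 : ℝ) ≤ 2.7182818283 ^ 7 := by norm_num
      _ ≤ _ := by gcongr
  rw [Real.exp_neg, one_div]
  exact inv_anti₀ (by norm_num) h

/-- The entropy factor of the links at the scale `4 ^ (-j)` is beaten by their tails: there are at
most `(3 * 4 ^ j) ^ d * (3 * 4 ^ (j + 1)) ^ d = (36 * 16 ^ j) ^ d` of them. -/
lemma entropy_mul_exp_le {d : ℕ} (hd : 1 ≤ d) (j : ℕ) :
    (36 * 16 ^ j : ℝ) ^ d * (2 * Real.exp (-(d * (4 ^ j * 7)))) ≤ 1 / 4 * (1 / 2) ^ j := by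
  have h4 : j + 1 ≤ 4 ^ j := Nat.lt_pow_self (by norm_num)
  have h4' : (j + 1 : ℝ) ≤ 4 ^ j := by exact_mod_cast h4
  have hq : Real.exp (-(4 ^ j * 7)) ≤ (1 / 1000) ^ (j + 1) := by
    calc Real.exp (-(4 ^ j * 7)) ≤ Real.exp (((j + 1 : ℕ) : ℝ) * (-7)) := by
          apply Real.exp_le_exp.2
          push_cast
          linarith
      _ = Real.exp (-7) ^ (j + 1) := Real.exp_nat_mul _ _
      _ ≤ _ := by
          gcongr
          exact exp_neg_seven_le
  have hb : 36 * 16 ^ j * Real.exp (-(4 ^ j * 7)) ≤ 1 / 8 * (1 / 2) ^ j := by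
    calc 36 * 16 ^ j * Real.exp (-(4 ^ j * 7)) ≤ 36 * 16 ^ j * (1 / 1000) ^ (j + 1) := by gcongr
      _ = 36 / 1000 * (16 / 1000) ^ j := by
          rw [pow_succ, div_pow, div_pow]; ring
      _ ≤ 1 / 8 * (1 / 2) ^ j := by gcongr ?_ * ?_ ^ _ <;> norm_num
  have hb1 : 36 * 16 ^ j * Real.exp (-(4 ^ j * 7)) ≤ 1 := by
    refine hb.trans ?_
    have : (1 / 2 : ℝ) ^ j ≤ 1 := pow_le_one₀ (by norm_num) (by norm_num)
    linarith
  have e : Real.exp (-(d * (4 ^ j * 7))) = Real.exp (-(4 ^ j * 7)) ^ d := by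
    rw [← Real.exp_nat_mul]; ring_nf
  rw [e]
  calc (36 * 16 ^ j : ℝ) ^ d * (2 * Real.exp (-(4 ^ j * 7)) ^ d)
      = 2 * (36 * 16 ^ j * Real.exp (-(4 ^ j * 7))) ^ d := by rw [mul_pow (36 * 16 ^ j)]; ring
    _ ≤ 2 * (36 * 16 ^ j * Real.exp (-(4 ^ j * 7))) := by
        gcongr
        exact pow_le_of_le_one (by positivity) hb1 (by omega)
    _ ≤ _ := by linarith

variable {P : Measure Ω} {X : E → Ω → ℝ} {ρ : ℝ} {v : ℝ≥0}

/-- The exponent in the tail of a link, for the threshold `√d (c + s) / 2 ^ j` and the variance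
proxy `w / 16 ^ j`, splits into a part depending on `s` and a part which beats the entropy. -/
lemma link_exponent_le {d : ℕ} (j : ℕ) {s : ℝ} (hs : 0 ≤ s) :
    -(√d * (chainLevel v ρ + s) / 2 ^ j) ^ 2 / (2 * (linkVariance v ρ / 16 ^ j)) ≤
      -(d * s ^ 2 / (2 * linkVariance v ρ)) + -(d * (4 ^ j * 7)) := by
  have hw := linkVariance_pos v ρ
  set w : ℝ := ((linkVariance v ρ : ℝ≥0) : ℝ)
  have hc := chainLevel_sq v ρ
  have hc0 := chainLevel_pos v ρ
  set c := chainLevel v ρ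
  have h4 : (1 : ℝ) ≤ 4 ^ j := one_le_pow₀ (by norm_num)
  have e : (16 : ℝ) ^ j = 2 ^ j * 2 ^ j * 4 ^ j := by
    rw [← mul_pow, ← mul_pow]; norm_num
  have e1 : -(√d * (c + s) / 2 ^ j) ^ 2 / (2 * (w / 16 ^ j)) =
      -(d * (4 ^ j * ((c + s) ^ 2 / (2 * w)))) := by
    rw [div_pow, mul_pow, Real.sq_sqrt (Nat.cast_nonneg d), e]
    field_simp
  rw [e1, ← neg_add, neg_le_neg_iff, mul_div_assoc, ← mul_add]
  gcongr
  have h5 : 7 + s ^ 2 / (2 * w) ≤ (c + s) ^ 2 / (2 * w) := by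
    rw [le_div_iff₀ (by positivity), add_mul, div_mul_cancel₀ _ (by positivity)]
    nlinarith [mul_nonneg hc0.le hs]
  have h6 : s ^ 2 / (2 * w) ≤ 4 ^ j * (s ^ 2 / (2 * w)) :=
    le_mul_of_one_le_left (by positivity) h4
  nlinarith [mul_le_mul_of_nonneg_left h5 (zero_le_one.trans h4)]

lemma IsSubgaussianField.link_tail [IsFiniteMeasure P] (hX : IsSubgaussianField P X ρ v)
    (hρ : 0 < ρ) {d j : ℕ} {s : ℝ} (hs : 0 ≤ s) {a b : E} (ha : ‖a‖ ≤ ρ) (hb : ‖b‖ ≤ ρ)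
    (hab : ‖a - b‖ ≤ 3 * ρ / 4 ^ j) :
    P {ω | √d * (chainLevel v ρ + s) / 2 ^ j ≤ |X a ω - X b ω|} ≤
      ENNReal.ofReal (Real.exp (-(d * s ^ 2 / (2 * linkVariance v ρ))) *
        (2 * Real.exp (-(d * (4 ^ j * 7))))) := by
  have hc := chainLevel_pos v ρ
  have hvar : v * ‖a - b‖₊ ^ 2 ≤ linkVariance v ρ / 16 ^ j := by
    rw [← NNReal.coe_le_coe]
    have hρ' : ((ρ.toNNReal : ℝ≥0) : ℝ) = ρ := Real.coe_toNNReal _ hρ.le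
    push_cast [linkVariance, hρ', coe_nnnorm]
    have e16 : (16 : ℝ) ^ j = 4 ^ j * 4 ^ j := by rw [← mul_pow]; norm_num
    calc (v : ℝ) * ‖a - b‖ ^ 2 ≤ v * (3 * ρ / 4 ^ j) ^ 2 := by gcongr
      _ = v * (9 * ρ ^ 2) / 16 ^ j := by rw [e16, div_pow]; ring
      _ ≤ _ := by
          gcongr
          have : (0 : ℝ) ≤ v := v.2
          linarith
  refine (measure_le_abs_of_hasSubgaussianMGF (hasSubgaussianMGF_mono (hX.sub a b ha hb) hvar)
    (by positivity)).trans (ENNReal.ofReal_le_ofReal ?_)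
  have := link_exponent_le (v := v) (ρ := ρ) (d := d) j hs
  push_cast
  calc _ ≤ 2 * Real.exp (-(d * s ^ 2 / (2 * linkVariance v ρ)) + -(d * (4 ^ j * 7))) := by
        gcongr
    _ = _ := by rw [Real.exp_add]; ring

lemma IsSubgaussianField.zero_tail [IsFiniteMeasure P] (hX : IsSubgaussianField P X ρ v)
    {d : ℕ} {s : ℝ} (hs : 0 ≤ s) :
    P {ω | √d * (chainLevel v ρ + s) ≤ |X 0 ω|} ≤
      ENNReal.ofReal (Real.exp (-(d * s ^ 2 / (2 * linkVariance v ρ))) *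
        (2 * Real.exp (-(d * 7)))) := by
  have hc := chainLevel_pos v ρ
  have hvar : v ≤ linkVariance v ρ := by
    unfold linkVariance
    calc v ≤ v * (1 + 9 * ρ.toNNReal ^ 2) := le_mul_of_one_le_right' le_self_add
      _ ≤ _ := le_self_add
  refine (measure_le_abs_of_hasSubgaussianMGF (hasSubgaussianMGF_mono hX.zero hvar)
    (by positivity)).trans (ENNReal.ofReal_le_ofReal ?_)
  have := link_exponent_le (v := v) (ρ := ρ) (d := d) 0 hs
  simp only [pow_zero, div_one, one_mul] at this
  calc _ ≤ 2 * Real.exp (-(d * s ^ 2 / (2 * linkVariance v ρ)) + -(d * 7)) := by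
        gcongr
    _ = _ := by rw [Real.exp_add]; ring

variable [NormedSpace ℝ E] {T : ℕ → Finset E} {π : ℕ → E → E}

/-- The union bound over all the links of the nets. -/
theorem IsSubgaussianField.measure_not_isChainBounded_le [IsFiniteMeasure P]
    (hX : IsSubgaussianField P X ρ v) (hT : IsNetSequence ρ T π) (hρ : 0 < ρ)
    (hd : 1 ≤ finrank ℝ E) {s : ℝ} (hs : 0 ≤ s) :
    P {ω | ¬ IsChainBounded ρ T (fun x => X x ω) (√(finrank ℝ E) * (chainLevel v ρ + s))} ≤
      ENNReal.ofReal (Real.exp (-(finrank ℝ E * s ^ 2 / (2 * linkVariance v ρ)))) := by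
  classical
  set d := finrank ℝ E
  set A := √d * (chainLevel v ρ + s) with hA
  set q := Real.exp (-(d * s ^ 2 / (2 * linkVariance v ρ))) with hq
  have hq0 : 0 ≤ q := Real.exp_nonneg _
  -- the links at the scale `ρ / 4 ^ j`
  let L : ℕ → Finset (E × E) := fun j =>
    (T j ×ˢ T (j + 1)).filter fun ab => ‖ab.1 - ab.2‖ ≤ 3 * ρ / 4 ^ j
  have hsub : {ω | ¬ IsChainBounded ρ T (fun x => X x ω) A} ⊆ {ω | A ≤ |X 0 ω|} ∪
      ⋃ j, ⋃ ab ∈ L j, {ω | A / 2 ^ j ≤ |X ab.1 ω - X ab.2 ω|} := by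
    intro ω hω
    by_contra hcon
    simp only [Set.mem_union, Set.mem_ofPred_eq, Set.mem_iUnion, not_or, not_exists, not_le] at hcon
    refine hω ⟨hcon.1, fun j a ha b hb hab => (hcon.2 j (a, b) ?_).le⟩
    simp [L, ha, hb, hab]
  have hcard : ∀ j, ((L j).card : ℝ) ≤ (36 * 16 ^ j) ^ d := by
    intro j
    have h1 : (L j).card ≤ (T j).card * (T (j + 1)).card :=
      (Finset.card_filter_le _ _).trans_eq (Finset.card_product _ _)
    calc ((L j).card : ℝ) ≤ (T j).card * (T (j + 1)).card := by exact_mod_cast h1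
      _ ≤ (3 * 4 ^ j) ^ d * (3 * 4 ^ (j + 1)) ^ d := by
          gcongr
          · exact hT.card_le j
          · exact hT.card_le (j + 1)
      _ = (36 * 16 ^ j) ^ d := by
          rw [← mul_pow]
          congr 1
          have : (16 : ℝ) ^ j = 4 ^ j * 4 ^ j := by rw [← mul_pow]; norm_num
          rw [this]
          ring
  have hscale : ∀ j, P (⋃ ab ∈ L j, {ω | A / 2 ^ j ≤ |X ab.1 ω - X ab.2 ω|}) ≤
      ENNReal.ofReal (q * (1 / 4 * (1 / 2) ^ j)) := by
    intro j
    calc _ ≤ ∑ ab ∈ L j, P {ω | A / 2 ^ j ≤ |X ab.1 ω - X ab.2 ω|} :=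
          measure_biUnion_finset_le _ _
      _ ≤ ∑ ab ∈ L j, ENNReal.ofReal (q * (2 * Real.exp (-(d * (4 ^ j * 7))))) := by
          refine Finset.sum_le_sum fun ab hab => ?_
          simp only [L, Finset.mem_filter, Finset.mem_product] at hab
          exact hX.link_tail hρ hs (hT.norm_le _ _ hab.1.1) (hT.norm_le _ _ hab.1.2) hab.2
      _ = ENNReal.ofReal ((L j).card * (q * (2 * Real.exp (-(d * (4 ^ j * 7)))))) := by
          rw [Finset.sum_const, nsmul_eq_mul, ENNReal.ofReal_mul (Nat.cast_nonneg _),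
            ENNReal.ofReal_natCast]
      _ ≤ _ := by
          refine ENNReal.ofReal_le_ofReal ?_
          calc _ ≤ (36 * 16 ^ j) ^ d * (q * (2 * Real.exp (-(d * (4 ^ j * 7))))) := by
                gcongr
                exact hcard j
            _ = q * ((36 * 16 ^ j) ^ d * (2 * Real.exp (-(d * (4 ^ j * 7))))) := by ring
            _ ≤ _ := by
                exact mul_le_mul_of_nonneg_left (entropy_mul_exp_le hd j) hq0
  have hzero : P {ω | A ≤ |X 0 ω|} ≤ ENNReal.ofReal (q * (1 / 2)) := by
    refine (hX.zero_tail hs).trans (ENNReal.ofReal_le_ofReal ?_)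
    gcongr
    have h1 : (1 : ℝ) ≤ d := by exact_mod_cast hd
    have h2 : Real.exp (-(d * 7)) ≤ Real.exp (-7) := Real.exp_le_exp.2 (by linarith)
    linarith [exp_neg_seven_le]
  have hgeom : HasSum (fun j : ℕ => q * (1 / 4 * (1 / 2 : ℝ) ^ j)) (q * (1 / 4 * 2)) :=
    (hasSum_geometric_two.mul_left _).mul_left _
  calc _ ≤ P {ω | A ≤ |X 0 ω|} +
        P (⋃ j, ⋃ ab ∈ L j, {ω | A / 2 ^ j ≤ |X ab.1 ω - X ab.2 ω|}) :=
        (measure_mono hsub).trans (measure_union_le _ _)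
    _ ≤ ENNReal.ofReal (q * (1 / 2)) + ∑' j : ℕ, ENNReal.ofReal (q * (1 / 4 * (1 / 2) ^ j)) := by
        gcongr
        exact (measure_iUnion_le _).trans (ENNReal.tsum_le_tsum hscale)
    _ = ENNReal.ofReal (q * (1 / 2)) + ENNReal.ofReal (q * (1 / 4 * 2)) := by
        rw [← ENNReal.ofReal_tsum_of_nonneg (fun j => by positivity) hgeom.summable,
          hgeom.tsum_eq]
    _ = ENNReal.ofReal q := by
        rw [← ENNReal.ofReal_add (by positivity) (by positivity)]
        congr 1
        ring

end Field

/-! ### Suprema of separable processes -/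

section ScaledSup
variable {E Ω : Type*}

/-- The supremum over `S` of `|Y x| / r`. -/
def scaledSup (r : ℝ) (S : Set E) (Y : E → Ω → ℝ) (ω : Ω) : ℝ≥0∞ :=
  ⨆ x ∈ S, ENNReal.ofReal (|Y x ω| / r)

variable [PseudoMetricSpace E] [MeasurableSpace Ω] {P : Measure Ω} {X : E → Ω → ℝ}

/-- A separable process has, almost surely, the same supremum over `S` as any other version has
over a suitable countable subset of `S`. -/
lemma exists_countable_scaledSup_eq {Y Z : E → Ω → ℝ} {S : Set E} (r : ℝ)
    (hZ : IsSeparableOn P Z S) (hZX : IsVersion P Z X) (hYX : IsVersion P Y X) :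
    ∃ D ⊆ S, D.Countable ∧ scaledSup r S Z =ᵐ[P] scaledSup r D Y := by
  obtain ⟨D, hDS, hD, hsep⟩ := hZ
  refine ⟨D, hDS, hD, ?_⟩
  have hZY : ∀ᵐ ω ∂P, ∀ x ∈ D, Z x ω = Y x ω :=
    (ae_ball_iff hD).2 fun x _ => (hZX x).trans (hYX x).symm
  filter_upwards [hsep, hZY] with ω hω hωD
  have e : scaledSup r D Y ω = scaledSup r D Z ω :=
    biSup_congr fun x hx => by rw [hωD x hx]
  rw [e]
  refine le_antisymm (iSup₂_le fun x hx => ?_) (biSup_mono hDS)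
  -- the bound by the supremum over `D` is a closed condition on the value `Z x`
  have hcl : IsClosed {z : ℝ | ENNReal.ofReal (|z| / r) ≤ scaledSup r D Z ω} :=
    isClosed_le (ENNReal.continuous_ofReal.comp (by fun_prop)) continuous_const
  refine hcl.closure_subset_iff.2 ?_ (hω x hx 1 one_pos)
  rintro _ ⟨y, hy, rfl⟩
  exact le_iSup₂ (f := fun x (_ : x ∈ D) => ENNReal.ofReal (|Z x ω| / r)) y hy.1

lemma aemeasurable_scaledSup {Z : E → Ω → ℝ} {S : Set E} (r : ℝ) (hX : ∀ x, AEMeasurable (X x) P)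
    (hZ : IsSeparableOn P Z S) (hZX : IsVersion P Z X) : AEMeasurable (scaledSup r S Z) P := by
  obtain ⟨D, -, hD, h⟩ := exists_countable_scaledSup_eq r hZ hZX (fun x => EventuallyEq.rfl)
  refine AEMeasurable.congr ?_ h.symm
  exact AEMeasurable.biSup D hD fun x _ => ((hX x).abs.div_const r).ennreal_ofReal

end ScaledSup

/-! ### The continuous version and the tail of the supremum -/

section Supremum
variable {E : Type*} [NormedAddCommGroup E] [NormedSpace ℝ E]
  {Ω : Type*} [MeasurableSpace Ω] {P : Measure Ω} {X : E → Ω → ℝ} {ρ : ℝ} {v : ℝ≥0}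
  {T : ℕ → Finset E} {π : ℕ → E → E}

/-- The value at a fixed point is almost surely the limit of the values along the nets. -/
lemma IsSubgaussianField.ae_tendsto_proj [IsFiniteMeasure P]
    (hX : IsSubgaussianField P X ρ v) (hT : IsNetSequence ρ T π) (hρ : 0 < ρ)
    {x : E} (hx : ‖x‖ ≤ ρ) :
    ∀ᵐ ω ∂P, Tendsto (fun j => X (π j x) ω) atTop (𝓝 (X x ω)) := by
  have hw := linkVariance_pos v ρ
  set w : ℝ := ((linkVariance v ρ : ℝ≥0) : ℝ) with hwdef
  set q : ℝ := Real.exp (-(1 / (2 * w))) with hq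
  have hq1 : q < 1 := Real.exp_lt_one_iff.2 (by simp; positivity)
  have hprob : ∀ j, P {ω | (1 / 2 : ℝ) ^ j ≤ |X (π j x) ω - X x ω|} ≤
      ENNReal.ofReal (2 * q ^ j) := by
    intro j
    have hπ : ‖π j x - x‖ ≤ ρ / 4 ^ j := by rw [norm_sub_rev]; exact hT.norm_sub_proj j x hx
    have hvar : v * ‖π j x - x‖₊ ^ 2 ≤ linkVariance v ρ / 16 ^ j := by
      rw [← NNReal.coe_le_coe]
      have hρ' : ((ρ.toNNReal : ℝ≥0) : ℝ) = ρ := Real.coe_toNNReal _ hρ.le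
      push_cast [linkVariance, hρ', coe_nnnorm]
      have e16 : (16 : ℝ) ^ j = 4 ^ j * 4 ^ j := by rw [← mul_pow]; norm_num
      calc (v : ℝ) * ‖π j x - x‖ ^ 2 ≤ v * (ρ / 4 ^ j) ^ 2 := by gcongr
        _ = v * ρ ^ 2 / 16 ^ j := by rw [e16, div_pow]; ring
        _ ≤ _ := by
            gcongr
            have hv : (0 : ℝ) ≤ v := v.2
            nlinarith [mul_nonneg hv (sq_nonneg ρ)]
    refine (measure_le_abs_of_hasSubgaussianMGF (hasSubgaussianMGF_mono
      (hX.sub _ _ (hT.norm_le j _ (hT.proj_mem j x hx)) hx) hvar)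
      (by positivity)).trans (ENNReal.ofReal_le_ofReal ?_)
    rw [hq, ← Real.exp_nat_mul]
    gcongr
    push_cast
    rw [← hwdef]
    have e : -((1 / 2 : ℝ) ^ j) ^ 2 / (2 * (w / 16 ^ j)) = -(4 ^ j * (1 / (2 * w))) := by
      have e16 : (16 : ℝ) ^ j = 2 ^ j * 2 ^ j * 4 ^ j := by rw [← mul_pow, ← mul_pow]; norm_num
      rw [e16, div_pow, one_pow]
      field_simp
    -- the threshold `2 ^ (-j)` is large compared to the standard deviation, of order `4 ^ (-j)`
    rw [e, mul_neg, neg_le_neg_iff]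
    gcongr
    exact_mod_cast (Nat.lt_pow_self (by norm_num : 1 < 4)).le
  have hsum : ∑' j, P {ω | (1 / 2 : ℝ) ^ j ≤ |X (π j x) ω - X x ω|} ≠ ∞ := by
    refine ne_top_of_le_ne_top ?_ (ENNReal.tsum_le_tsum hprob)
    exact ((summable_geometric_of_lt_one (Real.exp_nonneg _) hq1).mul_left 2).tsum_ofReal_ne_top
  filter_upwards [ae_eventually_notMem hsum] with ω hω
  rw [tendsto_iff_dist_tendsto_zero]
  refine squeeze_zero' (Eventually.of_forall fun j => dist_nonneg) ?_
    (tendsto_pow_atTop_nhds_zero_of_lt_one (r := (1 / 2 : ℝ)) (by norm_num) (by norm_num))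
  filter_upwards [hω] with j hj
  rw [Real.dist_eq]
  exact (not_le.1 hj).le

/-- The constant of the tail bound for a field which is sub-Gaussian, with variance proxy `v`, on
the ball of radius `ρ`. -/
def tailConst (v : ℝ≥0) (ρ : ℝ) : ℝ := 3 * chainLevel v ρ + 18 * linkVariance v ρ

lemma tailConst_pos (v : ℝ≥0) (ρ : ℝ) : 0 < tailConst v ρ := by
  have := chainLevel_pos v ρ
  have := linkVariance_pos v ρ
  unfold tailConst
  positivity

variable [FiniteDimensional ℝ E]

/-- The limit of the field along the nets is a version with continuous paths on the ball, and its
supremum has a Gaussian tail. -/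
theorem IsSubgaussianField.exists_continuous_version [IsFiniteMeasure P]
    (hX : IsSubgaussianField P X ρ v) (hρ : 0 < ρ) (hd : 1 ≤ finrank ℝ E) :
    ∃ Y : E → Ω → ℝ, IsVersion P Y X ∧
      (∀ᵐ ω ∂P, ContinuousOn (fun x => Y x ω) (closedBall 0 ρ)) ∧
      ∀ t : ℝ, 0 < t →
        P {ω | ¬ ∃ b < √(finrank ℝ E) * (tailConst v ρ + t), ∀ x, ‖x‖ ≤ ρ → |Y x ω| ≤ b} ≤
          ENNReal.ofReal (Real.exp (-(finrank ℝ E * t ^ 2 / tailConst v ρ))) := by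
  classical
  obtain ⟨T, π, hT⟩ := exists_isNetSequence (E := E) hρ
  have hc := chainLevel_pos v ρ
  have hw := linkVariance_pos v ρ
  have hd' : (1 : ℝ) ≤ finrank ℝ E := by exact_mod_cast hd
  -- `limUnder` is the limit on the almost sure event where the path is chain-bounded for some level
  let Y : E → Ω → ℝ := fun x ω =>
    if ‖x‖ ≤ ρ then limUnder atTop (fun j => X (π j x) ω) else X x ω
  have hY : ∀ {ω A}, IsChainBounded ρ T (fun x => X x ω) A →
      (∃ b < 3 * A, ∀ x, ‖x‖ ≤ ρ → |Y x ω| ≤ b) ∧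
        ContinuousOn (fun x => Y x ω) (closedBall 0 ρ) := by
    intro ω A hA
    obtain ⟨g, hg, ⟨b, hb, hgb⟩, hgc⟩ := hA.exists_limit hT hρ
    have hYg : ∀ x, ‖x‖ ≤ ρ → Y x ω = g x := fun x hx => by
      simp only [Y, if_pos hx]
      exact (hg x hx).limUnder_eq
    refine ⟨⟨b, hb, fun x hx => by rw [hYg x hx]; exact hgb x hx⟩, hgc.congr fun x hx => ?_⟩
    exact hYg x (mem_closedBall_zero_iff.1 hx)
  refine ⟨Y, fun x => ?_, ?_, fun t ht => ?_⟩
  · by_cases hx : ‖x‖ ≤ ρ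
    · filter_upwards [hX.ae_tendsto_proj hT hρ hx] with ω hω
      simp only [Y, if_pos hx]
      exact hω.limUnder_eq
    · filter_upwards with ω
      simp only [Y, if_neg hx]
  · -- the complementary event is contained in events of arbitrarily small probability
    have hle : ∀ n : ℕ, P {ω | ¬ ContinuousOn (fun x => Y x ω) (closedBall 0 ρ)} ≤
        ENNReal.ofReal (Real.exp (-(1 / (2 * linkVariance v ρ) * n))) := by
      intro n
      refine (measure_mono (Set.ofPred_subset_ofPred.2 fun ω => mt fun hcon => (hY hcon).2)).trans
        ((hX.measure_not_isChainBounded_le hT hρ hd (Nat.cast_nonneg n)).trans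
        (ENNReal.ofReal_le_ofReal (Real.exp_le_exp.2 ?_)))
      have h1 : (n : ℝ) ≤ finrank ℝ E * (n : ℝ) ^ 2 := by
        have h2 : (n : ℝ) ≤ (n : ℝ) ^ 2 := by exact_mod_cast Nat.le_self_pow (by norm_num) n
        nlinarith [sq_nonneg (n : ℝ)]
      rw [neg_le_neg_iff, div_mul_eq_mul_div, one_mul]
      gcongr
    have hlim : Tendsto (fun n : ℕ => ENNReal.ofReal
        (Real.exp (-(1 / (2 * linkVariance v ρ) * n)))) atTop (𝓝 0) := by
      rw [← ENNReal.ofReal_zero]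
      refine ENNReal.tendsto_ofReal (Real.tendsto_exp_neg_atTop_nhds_zero.comp ?_)
      exact tendsto_natCast_atTop_atTop.const_mul_atTop (by positivity)
    exact le_antisymm (ge_of_tendsto' hlim hle) bot_le
  · have hs : 0 ≤ t / 3 := by positivity
    refine (measure_mono (Set.ofPred_subset_ofPred.2 fun ω => mt fun hcon => ?_)).trans
      ((hX.measure_not_isChainBounded_le hT hρ hd hs).trans
      (ENNReal.ofReal_le_ofReal (Real.exp_le_exp.2 ?_)))
    · obtain ⟨⟨b, hb, h⟩, -⟩ := hY hcon
      refine ⟨b, hb.trans_le ?_, h⟩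
      have h3 : 3 * (√(finrank ℝ E) * (chainLevel v ρ + t / 3)) =
        √(finrank ℝ E) * (3 * chainLevel v ρ + t) := by ring
      rw [h3, tailConst]
      gcongr
      linarith
    · rw [neg_le_neg_iff]
      have h4 : finrank ℝ E * (t / 3) ^ 2 / (2 * linkVariance v ρ) =
        finrank ℝ E * t ^ 2 / (18 * linkVariance v ρ) := by field_simp; ring
      rw [h4, tailConst]
      gcongr
      linarith

/-- The tail bound for any separable version of a sub-Gaussian field. -/
theorem IsSubgaussianField.scaledSup_tail [IsFiniteMeasure P]
    (hX : IsSubgaussianField P X ρ v) (hρ : 0 < ρ) (hd : 1 ≤ finrank ℝ E) {Z : E → Ω → ℝ}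
    (hZX : IsVersion P Z X) (hZ : IsSeparableOn P Z (closedBall 0 ρ)) {t : ℝ} (ht : 0 < t) :
    P {ω | ENNReal.ofReal (tailConst v ρ + t) ≤
        scaledSup (√(finrank ℝ E)) (closedBall 0 ρ) Z ω} ≤
      ENNReal.ofReal (Real.exp (-(finrank ℝ E * t ^ 2 / tailConst v ρ))) := by
  obtain ⟨Y, hYX, -, htail⟩ := hX.exists_continuous_version hρ hd
  obtain ⟨D, hDS, -, hD⟩ := exists_countable_scaledSup_eq (√(finrank ℝ E)) hZ hZX hYX
  refine (measure_mono_ae ?_).trans (htail t ht)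
  filter_upwards [hD] with ω hω hle
  rintro ⟨b, hb, hYb⟩
  have hle' : ENNReal.ofReal (tailConst v ρ + t) ≤
    scaledSup (√(finrank ℝ E)) (closedBall 0 ρ) Z ω := hle
  have hr : 0 < √(finrank ℝ E : ℝ) := Real.sqrt_pos.2 (by exact_mod_cast hd)
  have hpos : 0 < tailConst v ρ + t := add_pos (tailConst_pos v ρ) ht
  have hsup : scaledSup (√(finrank ℝ E)) D Y ω ≤ ENNReal.ofReal (b / √(finrank ℝ E)) := by
    refine iSup₂_le fun x hx => ENNReal.ofReal_le_ofReal ?_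
    have := hYb x (mem_closedBall_zero_iff.1 (hDS hx))
    gcongr
  rw [hω] at hle'
  have hlt : ENNReal.ofReal (b / √(finrank ℝ E)) < ENNReal.ofReal (tailConst v ρ + t) := by
    rw [ENNReal.ofReal_lt_ofReal_iff hpos, div_lt_iff₀ hr]
    linarith
  exact absurd (hle'.trans hsup) (not_le.2 hlt)

end Supremum

/-! ### Moments from tails -/

section Moments
variable {Ω : Type*} [MeasurableSpace Ω] {P : Measure Ω}

/-- A bound for the moment of order `k` of a nonnegative variable with the tail
`C * exp (-t ^ 2 / κ)` beyond `κ`, obtained by slicing its range into intervals of length one. -/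
def momentBound (κ C : ℝ) (k : ℕ) : ℝ≥0∞ :=
  ENNReal.ofReal (κ + 1) ^ k +
    ∑' n : ℕ, ENNReal.ofReal ((κ + n + 2) ^ k * (C * Real.exp (-((n + 1) ^ 2 / κ))))

lemma momentBound_ne_top {κ C : ℝ} (hκ : 0 < κ) (hC : 0 ≤ C) (k : ℕ) :
    momentBound κ C k ≠ ∞ := by
  rw [momentBound, ENNReal.add_ne_top]
  refine ⟨ENNReal.pow_ne_top ENNReal.ofReal_ne_top, Summable.tsum_ofReal_ne_top ?_⟩
  set q := Real.exp (-(1 / κ)) with hq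
  have hq1 : ‖q‖ < 1 := by
    rw [Real.norm_of_nonneg (Real.exp_nonneg _)]
    exact Real.exp_lt_one_iff.2 (by simp [hκ])
  have hs : Summable fun n : ℕ => ((n + 1 : ℕ) : ℝ) ^ k * q ^ (n + 1) :=
    (summable_nat_add_iff (f := fun n : ℕ => (n : ℝ) ^ k * q ^ n) 1).2
      (summable_pow_mul_geometric_of_norm_lt_one k hq1)
  refine Summable.of_nonneg_of_le (fun n => by positivity) (fun n => ?_)
    (hs.mul_left ((κ + 2) ^ k * C))
  have hn : (0 : ℝ) ≤ n := Nat.cast_nonneg n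
  have h1 : (κ + n + 2) ^ k ≤ (κ + 2) ^ k * ((n + 1 : ℕ) : ℝ) ^ k := by
    rw [← mul_pow]
    push_cast
    gcongr
    nlinarith
  have h2 : Real.exp (-((n + 1) ^ 2 / κ)) ≤ q ^ (n + 1) := by
    rw [hq, ← Real.exp_nat_mul]
    refine Real.exp_le_exp.2 ?_
    rw [mul_neg, neg_le_neg_iff, mul_one_div]
    push_cast
    gcongr
    nlinarith
  refine (mul_le_mul h1 (mul_le_mul_of_nonneg_left h2 hC) (by positivity)
    (by positivity)).trans_eq ?_
  ring

lemma lintegral_pow_le_momentBound [IsProbabilityMeasure P] {S : Ω → ℝ≥0∞} {κ C : ℝ} (hκ : 0 < κ)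
    (hS : AEMeasurable S P)
    (htail : ∀ t : ℝ, 0 < t →
      P {ω | ENNReal.ofReal (κ + t) ≤ S ω} ≤ ENNReal.ofReal (C * Real.exp (-(t ^ 2 / κ))))
    (k : ℕ) : ∫⁻ ω, S ω ^ k ∂P ≤ momentBound κ C k := by
  let F : ℕ → Set Ω := fun n => {ω | ENNReal.ofReal (κ + (n + 1)) ≤ S ω}
  let c : ℕ → ℝ≥0∞ := fun n => ENNReal.ofReal ((κ + n + 2) ^ k)
  have hF : ∀ n, NullMeasurableSet (F n) P := fun n => nullMeasurableSet_le aemeasurable_const hS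
  have hpt : ∀ ω, S ω ^ k ≤
      ENNReal.ofReal (κ + 1) ^ k + ∑' n, (F n).indicator (fun _ => c n) ω := by
    intro ω
    by_cases hω : S ω ≤ ENNReal.ofReal (κ + 1)
    · exact (pow_le_pow_left' hω k).trans le_self_add
    rw [not_le] at hω
    refine le_trans ?_ le_add_self
    -- where `S` is infinite, all the terms of the series are at least one
    by_cases htop : S ω = ∞
    · have hc : ∀ n, (1 : ℝ≥0∞) ≤ (F n).indicator (fun _ => c n) ω := by
        intro n
        have hmem : ω ∈ F n := show ENNReal.ofReal (κ + (n + 1)) ≤ S ω by rw [htop]; exact le_top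
        rw [Set.indicator_of_mem hmem]
        refine ENNReal.one_le_ofReal.2 (one_le_pow₀ ?_)
        have : (0 : ℝ) ≤ n := Nat.cast_nonneg n
        linarith
      calc S ω ^ k ≤ ∞ := le_top
        _ = ∑' _ : ℕ, (1 : ℝ≥0∞) := (ENNReal.tsum_const_eq_top_of_ne_zero one_ne_zero).symm
        _ ≤ _ := ENNReal.tsum_le_tsum hc
    · obtain ⟨x, hx⟩ : ∃ x : ℝ≥0, S ω = x := ⟨(S ω).toNNReal, (ENNReal.coe_toNNReal htop).symm⟩
      have hx1 : κ + 1 < x := by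
        rw [hx, ← ENNReal.ofReal_coe_nnreal] at hω
        exact (ENNReal.ofReal_lt_ofReal_iff_of_nonneg (by linarith)).1 hω
      -- the slice `κ + n + 1 ≤ S < κ + n + 2`
      let n := ⌊(x : ℝ) - κ - 1⌋₊
      have hn1 : (n : ℝ) ≤ x - κ - 1 := Nat.floor_le (by linarith)
      have hn2 : (x : ℝ) - κ - 1 < n + 1 := Nat.lt_floor_add_one _
      refine le_trans ?_ (ENNReal.le_tsum n)
      have hmem : ω ∈ F n := by
        show ENNReal.ofReal (κ + (n + 1)) ≤ S ω
        rw [hx, ← ENNReal.ofReal_coe_nnreal]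
        exact ENNReal.ofReal_le_ofReal (by linarith)
      rw [Set.indicator_of_mem hmem, hx, ← ENNReal.ofReal_coe_nnreal,
        ← ENNReal.ofReal_pow (show (0 : ℝ) ≤ x from x.2)]
      refine ENNReal.ofReal_le_ofReal ?_
      have : (0 : ℝ) ≤ x := x.2
      gcongr
      linarith
  calc ∫⁻ ω, S ω ^ k ∂P
      ≤ ∫⁻ ω, ENNReal.ofReal (κ + 1) ^ k + ∑' n, (F n).indicator (fun _ => c n) ω ∂P :=
        lintegral_mono hpt
    _ = ENNReal.ofReal (κ + 1) ^ k + ∑' n, c n * P (F n) := by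
        rw [lintegral_add_left measurable_const, lintegral_const, measure_univ, mul_one,
          lintegral_tsum fun n => aemeasurable_const.indicator₀ (hF n)]
        congr 1
        refine tsum_congr fun n => lintegral_indicator_const₀ (hF n) _
    _ ≤ momentBound κ C k := by
        refine add_le_add le_rfl (ENNReal.tsum_le_tsum fun n => ?_)
        rw [ENNReal.ofReal_mul (by positivity)]
        exact mul_le_mul_right (htail (n + 1) (by positivity)) _

end Moments

/-! ### Separability of continuous processes -/

section Separable

lemma isSeparableOn_of_continuousOn {Ω T : Type*} [MeasurableSpace Ω] {P : Measure Ω}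
    [PseudoMetricSpace T] [SecondCountableTopology T] {Y : T → Ω → ℝ} {S : Set T}
    (hY : ∀ᵐ ω ∂P, ContinuousOn (fun x => Y x ω) S) : IsSeparableOn P Y S := by
  obtain ⟨D, hDS, hD, hSD⟩ :=
    (TopologicalSpace.IsSeparable.of_separableSpace S).exists_countable_dense_subset
  refine ⟨D, hDS, hD, ?_⟩
  filter_upwards [hY] with ω hω x hx ε hε
  have hmem : x ∈ closure (D ∩ ball x ε) := by
    rw [Set.inter_comm]
    exact isOpen_ball.inter_closure ⟨mem_ball_self hε, hSD hx⟩
  exact ((hω x hx).mono (Set.inter_subset_left.trans hDS)).mem_closure_image hmem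

end Separable

/-! ### Elementary tensors and symmetric couplings -/

section Tensor
variable {N p : ℕ}

lemma sum_prod_sq (v : Fin p → EuclideanSpace ℝ (Fin N)) :
    ∑ i : Fin p → Fin N, (∏ j, v j (i j)) ^ 2 = ∏ j, ‖v j‖ ^ 2 := by
  simp_rw [EuclideanSpace.real_norm_sq_eq, Finset.prod_univ_sum, Fintype.piFinset_univ,
    Finset.prod_pow]

/-- The elementary tensor `⨂ⱼ u j` is Lipschitz in `u`, for the Hilbert-Schmidt norm, on the
product of the unit balls. -/
lemma sum_prod_sub_prod_sq_le {δ : ℝ} (u v : Fin p → EuclideanSpace ℝ (Fin N))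
    (hu : ∀ j, ‖u j‖ ≤ 1) (hv : ∀ j, ‖v j‖ ≤ 1) (huv : ∀ j, ‖u j - v j‖ ≤ δ) :
    ∑ i : Fin p → Fin N, (∏ j, u j (i j) - ∏ j, v j (i j)) ^ 2 ≤ 4 ^ p * δ ^ 2 := by
  induction p with
  | zero => simpa using sq_nonneg δ
  | succ p ih =>
    have hih := ih (fun j => u j.succ) (fun j => v j.succ) (fun j => hu _) (fun j => hv _)
      (fun j => huv _)
    set U : (Fin p → Fin N) → ℝ := fun i => ∏ j, u j.succ (i j) with hU
    set V : (Fin p → Fin N) → ℝ := fun i => ∏ j, v j.succ (i j) with hV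
    have hVsum : ∑ i, V i ^ 2 ≤ 1 := by
      rw [hV, sum_prod_sq]
      exact Finset.prod_le_one (fun j _ => by positivity)
        fun j _ => pow_le_one₀ (norm_nonneg _) (hv _)
    have ha : ∑ k, u 0 k ^ 2 ≤ 1 := by
      rw [← EuclideanSpace.real_norm_sq_eq]
      exact pow_le_one₀ (norm_nonneg _) (hu 0)
    have hab : ∑ k, (u 0 k - v 0 k) ^ 2 ≤ δ ^ 2 := by
      have h := EuclideanSpace.real_norm_sq_eq (u 0 - v 0)
      simp only [PiLp.sub_apply] at h
      rw [← h]
      exact pow_le_pow_left₀ (norm_nonneg _) (huv 0) 2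
    have hUV : 0 ≤ ∑ i, (U i - V i) ^ 2 := Finset.sum_nonneg fun i _ => sq_nonneg _
    have hV0 : 0 ≤ ∑ i, V i ^ 2 := Finset.sum_nonneg fun i _ => sq_nonneg _
    calc ∑ i : Fin (p + 1) → Fin N, (∏ j, u j (i j) - ∏ j, v j (i j)) ^ 2
        = ∑ k, ∑ i, (u 0 k * U i - v 0 k * V i) ^ 2 := by
          rw [← (Fin.consEquiv (fun _ : Fin (p + 1) => Fin N)).sum_comp, Fintype.sum_prod_type]
          simp [Fin.prod_univ_succ, Fin.consEquiv, hU, hV]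
      _ ≤ ∑ k, ∑ i, (2 * (u 0 k ^ 2 * (U i - V i) ^ 2) + 2 * ((u 0 k - v 0 k) ^ 2 * V i ^ 2)) := by
          refine Finset.sum_le_sum fun k _ => Finset.sum_le_sum fun i _ => ?_
          nlinarith [sq_nonneg (u 0 k * (U i - V i) - (u 0 k - v 0 k) * V i)]
      _ = 2 * ((∑ k, u 0 k ^ 2) * ∑ i, (U i - V i) ^ 2) +
          2 * ((∑ k, (u 0 k - v 0 k) ^ 2) * ∑ i, V i ^ 2) := by
          simp_rw [Finset.sum_add_distrib, ← Finset.mul_sum, ← Finset.sum_mul]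
      _ ≤ 2 * (1 * (4 ^ p * δ ^ 2)) + 2 * (δ ^ 2 * 1) := by gcongr
      _ ≤ 4 ^ (p + 1) * δ ^ 2 := by
          have : (1 : ℝ) ≤ 4 ^ p := one_le_pow₀ (by norm_num)
          rw [pow_succ (4 : ℝ)]
          nlinarith [mul_nonneg (sub_nonneg.2 this) (sq_nonneg δ)]

/-- The tuples with a given multiset of entries are among the `p ^ p` reindexings of one of
them. -/
lemma card_indexMultiset_fiber_le (s : Sym (Fin N) p) :
    (Finset.univ.filter fun i : Fin p → Fin N => indexMultiset i = s).card ≤ p ^ p := by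
  classical
  rcases (Finset.univ.filter fun i : Fin p → Fin N => indexMultiset i = s).eq_empty_or_nonempty
    with h | ⟨i₀, h₀⟩
  · simp [h]
  · have hsub : (Finset.univ.filter fun i : Fin p → Fin N => indexMultiset i = s) ⊆
        (Finset.univ : Finset (Fin p → Fin p)).image fun σ => i₀ ∘ σ := by
      intro i hi
      have h1 : (Finset.univ.val.map i : Multiset (Fin N)) = Finset.univ.val.map i₀ :=
        congrArg Subtype.val
          ((Finset.mem_filter.1 hi).2.trans (Finset.mem_filter.1 h₀).2.symm)
      have h2 : ∀ j, ∃ k, i₀ k = i j := by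
        intro j
        have : i j ∈ (Finset.univ.val.map i₀ : Multiset (Fin N)) := by
          rw [← h1]
          exact Multiset.mem_map_of_mem i (Finset.mem_univ_val j)
        obtain ⟨k, -, hk⟩ := Multiset.mem_map.1 this
        exact ⟨k, hk⟩
      choose σ hσ using h2
      exact Finset.mem_image.2 ⟨σ, Finset.mem_univ _, funext hσ⟩
    calc _ ≤ _ := Finset.card_le_card hsub
      _ ≤ _ := Finset.card_image_le
      _ = p ^ p := by simp

lemma multFactorial_le (s : Sym (Fin N) p) : multFactorial s ≤ p ! := by
  have h : ∑ k : Fin N, Multiset.count k (s : Multiset (Fin N)) = p := by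
    rw [Multiset.sum_count_eq_card fun a _ => Finset.mem_univ a]
    exact s.2
  have := Nat.le_of_dvd (Nat.factorial_pos _)
    (Nat.prod_factorial_dvd_factorial_sum Finset.univ
      fun k : Fin N => Multiset.count k (s : Multiset (Fin N)))
  rwa [h] at this

/-- The left side is the variance of `∑ᵢ J_{[i]} wᵢ`, up to the factor `N ^ (p - 1)`. It is bounded
by the squared Hilbert-Schmidt norm of `w`, by the Cauchy-Schwarz inequality on the fibers of
`i ↦ [i]`. -/
lemma sum_multFactorial_mul_sq_le (w : (Fin p → Fin N) → ℝ) :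
    ∑ s : Sym (Fin N) p, (multFactorial s : ℝ) *
        (∑ i ∈ Finset.univ.filter fun i => indexMultiset i = s, w i) ^ 2 ≤
      p ! * p ^ p * ∑ i, w i ^ 2 := by
  classical
  rw [← Finset.sum_fiberwise Finset.univ (indexMultiset (N := N) (p := p)), Finset.mul_sum]
  refine Finset.sum_le_sum fun s _ => ?_
  have h1 : (multFactorial s : ℝ) ≤ p ! := by exact_mod_cast multFactorial_le s
  have h2 : ((Finset.univ.filter fun i : Fin p → Fin N => indexMultiset i = s).card : ℝ) ≤
      p ^ p := by exact_mod_cast card_indexMultiset_fiber_le s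
  rw [mul_assoc]
  gcongr
  refine sq_sum_le_card_mul_sum_sq.trans ?_
  gcongr

end Tensor

/-! ### The norm of the disorder -/

section Disorder
variable {Ω : Type*} {N : ℕ+} {m : ℕ}
  {J : (q : Fin m) → Sym (Fin N) (q + 1) → Ω → ℝ}

/-- The `p`-linear form of the disorder (`p = q + 1`), as a random field on the product of `p`
copies of `ℝ^N`. The factor `√p` accounts for the dimension `p * N` of this space, so that
`|disorderField| / √(p * N)` is the quantity in the definition of `disorderNorm`. -/
def disorderField (J : (q : Fin m) → Sym (Fin N) (q + 1) → Ω → ℝ) (q : Fin m)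
    (u : Fin (q + 1) → EuclideanSpace ℝ (Fin N)) (ω : Ω) : ℝ :=
  √((q + 1 : ℕ) : ℝ) * ∑ i : Fin (q + 1) → Fin N,
    (√(N : ℝ)) ^ (q : ℕ) * J q (indexMultiset i) ω * ∏ j, u j (i j)

lemma finrank_disorder (N : ℕ+) (p : ℕ) :
    finrank ℝ (Fin p → EuclideanSpace ℝ (Fin N)) = p * N := by
  simp [Module.finrank_pi_fintype]

lemma disorderNorm_eq :
    disorderNorm N m J = fun ω => ⨆ q : Fin m,
      scaledSup (√(finrank ℝ (Fin (q + 1) → EuclideanSpace ℝ (Fin N)))) (closedBall 0 1)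
        (disorderField J q) ω := by
  funext ω
  refine iSup_congr fun q => iSup_congr fun u => ?_
  have hball : u ∈ closedBall (0 : Fin (q + 1) → EuclideanSpace ℝ (Fin N)) 1 ↔ ∀ j, ‖u j‖ ≤ 1 := by
    rw [mem_closedBall_zero_iff, pi_norm_le_iff_of_nonneg zero_le_one]
  refine iSup_congr_Prop hball.symm fun _ => ?_
  have hq : (0 : ℝ) < √((q + 1 : ℕ) : ℝ) := Real.sqrt_pos.2 (by positivity)
  rw [finrank_disorder, Nat.cast_mul, Real.sqrt_mul (Nat.cast_nonneg _), disorderField, abs_mul,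
    abs_mul, abs_of_pos hq, mul_div_mul_left _ _ hq.ne', abs_of_nonneg (by positivity)]
  congr 1
  rw [div_eq_inv_mul]

lemma continuous_disorderField (q : Fin m) (ω : Ω) :
    Continuous fun u => disorderField J q u ω := by
  unfold disorderField
  fun_prop

variable [MeasurableSpace Ω] {P : Measure Ω}

/-- The variance proxy, on the unit ball, of the `p`-linear form of the disorder. -/
def disorderVariance (p : ℕ) : ℝ≥0 := p * (p ! * p ^ p * 4 ^ p)

lemma IsDisorder.isSubgaussianField [IsProbabilityMeasure P] (hJ : IsDisorder P N m J)
    (q : Fin m) :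
    IsSubgaussianField P (disorderField J q) 1 (disorderVariance (q + 1)) where
  zero := by
    have h : disorderField J q 0 = fun _ => 0 := by
      funext ω
      simp [disorderField]
    rw [h]
    exact hasSubgaussianMGF_mono HasSubgaussianMGF.fun_zero bot_le
  sub u v hu hv := by
    classical
    rw [pi_norm_le_iff_of_nonneg zero_le_one] at hu hv
    set w : (Fin (q + 1) → Fin N) → ℝ := fun i => ∏ j, u j (i j) - ∏ j, v j (i j) with hw
    set a : Sym (Fin N) (q + 1) → ℝ := fun s => √((q + 1 : ℕ) : ℝ) * (√(N : ℝ)) ^ (q : ℕ) *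
      ∑ i ∈ Finset.univ.filter (fun i => indexMultiset i = s), w i
    have hsum : ∀ ω, disorderField J q u ω - disorderField J q v ω =
        ∑ s, a s * J q s ω := by
      intro ω
      rw [disorderField, disorderField, ← mul_sub, ← Finset.sum_sub_distrib,
        ← Finset.sum_fiberwise Finset.univ (indexMultiset (N := N) (p := q + 1)), Finset.mul_sum]
      refine Finset.sum_congr rfl fun s _ => ?_
      simp only [a]
      rw [Finset.mul_sum, Finset.mul_sum, Finset.sum_mul]
      refine Finset.sum_congr rfl fun i hi => ?_
      rw [(Finset.mem_filter.1 hi).2]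
      ring
    have hlaw : ∀ s, HasSubgaussianMGF (fun ω => a s * J q s ω)
        (⟨a s ^ 2, sq_nonneg _⟩ * ((multFactorial s : ℝ≥0) / (N : ℝ≥0) ^ (q : ℕ))) P := fun s =>
      (hasSubgaussianMGF_of_map_eq_gaussianReal (hJ.hasLaw q s).aemeasurable
        (hJ.hasLaw q s).map_eq).const_mul (a s)
    have hindep : iIndepFun (fun s ω => a s * J q s ω) P :=
      (hJ.indep.precomp (g := fun s : Sym (Fin N) (q + 1) =>
          (⟨q, s⟩ : (q : Fin m) × Sym (Fin N) (q + 1)))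
        fun s t h => eq_of_heq (Sigma.mk.inj h).2).comp (fun s x => a s * x)
        fun s => measurable_const_mul _
    have hfield := HasSubgaussianMGF.sum_of_iIndepFun hindep (s := Finset.univ) fun s _ => hlaw s
    simp_rw [hsum]
    refine hasSubgaussianMGF_mono hfield ?_
    rw [← NNReal.coe_le_coe]
    push_cast [disorderVariance]
    have hN : (0 : ℝ) < (N : ℝ) := by exact_mod_cast N.pos
    have hterm : ∀ s, a s ^ 2 * ((multFactorial s : ℝ) / (N : ℝ) ^ (q : ℕ)) =
        (q + 1 : ℕ) * ((multFactorial s : ℝ) *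
          (∑ i ∈ Finset.univ.filter fun i => indexMultiset i = s, w i) ^ 2) := by
      intro s
      simp only [a]
      rw [mul_pow, mul_pow, Real.sq_sqrt (Nat.cast_nonneg _), ← pow_mul, mul_comm (q : ℕ) 2,
        pow_mul, Real.sq_sqrt hN.le]
      field_simp
    calc _ = ∑ s, a s ^ 2 * ((multFactorial s : ℝ) / (N : ℝ) ^ (q : ℕ)) := rfl
      _ = (q + 1 : ℕ) * ∑ s : Sym (Fin N) (q + 1), (multFactorial s : ℝ) *
          (∑ i ∈ Finset.univ.filter fun i => indexMultiset i = s, w i) ^ 2 := by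
          rw [Finset.mul_sum]
          exact Finset.sum_congr rfl fun s _ => hterm s
      _ ≤ (q + 1 : ℕ) *
          ((q + 1)! * (q + 1 : ℕ) ^ (q + 1 : ℕ) * (4 ^ (q + 1 : ℕ) * ‖u - v‖ ^ 2)) := by
          refine mul_le_mul_of_nonneg_left ((sum_multFactorial_mul_sq_le w).trans ?_)
            (Nat.cast_nonneg _)
          refine mul_le_mul_of_nonneg_left ?_ (by positivity)
          exact sum_prod_sub_prod_sq_le u v hu hv fun j => norm_le_pi_norm (u - v) j
      _ = _ := by
          push_cast
          ring

lemma IsDisorder.aemeasurable_disorderField (hJ : IsDisorder P N m J)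
    (q : Fin m) (u : Fin (q + 1) → EuclideanSpace ℝ (Fin N)) :
    AEMeasurable (disorderField J q u) P := by
  have h : ∀ s, AEMeasurable (J q s) P := fun s => (hJ.hasLaw q s).aemeasurable
  unfold disorderField
  exact (Finset.aemeasurable_fun_sum _ fun i _ =>
    ((h _).const_mul _).mul_const _).const_mul _

/-- The constant of the tail bound for the norm of the disorder. -/
def disorderTailConst (m : ℕ) : ℝ :=
  1 + ∑ q : Fin m, tailConst (disorderVariance (q + 1)) 1

lemma disorderTailConst_pos (m : ℕ) : 0 < disorderTailConst m :=
  add_pos_of_pos_of_nonneg one_pos (Finset.sum_nonneg fun _ _ => (tailConst_pos _ _).le)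

lemma isSeparableOn_disorderField (q : Fin m) :
    IsSeparableOn P (disorderField J q) (closedBall 0 1) :=
  isSeparableOn_of_continuousOn
    (Eventually.of_forall fun ω => (continuous_disorderField q ω).continuousOn)

lemma IsDisorder.aemeasurable_disorderNorm (hJ : IsDisorder P N m J) :
    AEMeasurable (disorderNorm N m J) P := by
  rw [disorderNorm_eq]
  exact AEMeasurable.iSup fun q => aemeasurable_scaledSup _ (hJ.aemeasurable_disorderField q)
    (isSeparableOn_disorderField q) fun u => EventuallyEq.rfl

theorem IsDisorder.disorderNorm_tail [IsProbabilityMeasure P] (hJ : IsDisorder P N m J)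
    {t : ℝ} (ht : 0 < t) :
    P {ω | ENNReal.ofReal (disorderTailConst m + t) ≤ disorderNorm N m J ω} ≤
      ENNReal.ofReal (m * Real.exp (-((N : ℝ) * t ^ 2 / disorderTailConst m))) := by
  have hpos := disorderTailConst_pos m
  set κ := disorderTailConst m with hκ
  have hle : ∀ q : Fin m, tailConst (disorderVariance (q + 1)) 1 ≤ κ := fun q => by
    have := Finset.single_le_sum (f := fun q : Fin m => tailConst (disorderVariance (q + 1)) 1)
      (fun q _ => (tailConst_pos _ _).le) (Finset.mem_univ q)
    rw [hκ, disorderTailConst]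
    linarith
  let S : Fin m → Ω → ℝ≥0∞ := fun q => scaledSup
    (√(finrank ℝ (Fin (q + 1) → EuclideanSpace ℝ (Fin N)))) (closedBall 0 1) (disorderField J q)
  have hsub : {ω | ENNReal.ofReal (κ + t) ≤ disorderNorm N m J ω} ⊆
      ⋃ q ∈ (Finset.univ : Finset (Fin m)), {ω | ENNReal.ofReal (κ + t) ≤ S q ω} := by
    intro ω hω
    have h1 : ENNReal.ofReal (κ + t) ≤ ⨆ q, S q ω := by
      have : ENNReal.ofReal (κ + t) ≤ disorderNorm N m J ω := hω
      rwa [disorderNorm_eq] at this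
    -- for `m = 0` the norm vanishes, below the positive threshold
    have hne : Nonempty (Fin m) := by
      by_contra hempty
      rw [not_nonempty_iff] at hempty
      rw [iSup_of_empty, le_bot_iff] at h1
      exact (ENNReal.ofReal_pos.2 (add_pos hpos ht)).ne' h1
    obtain ⟨q, hq⟩ := exists_eq_ciSup_of_finite (f := fun q => S q ω)
    rw [← hq] at h1
    exact Set.mem_biUnion (Finset.mem_coe.2 (Finset.mem_univ q)) h1
  have hq : ∀ q : Fin m, P {ω | ENNReal.ofReal (κ + t) ≤ S q ω} ≤
      ENNReal.ofReal (Real.exp (-((N : ℝ) * t ^ 2 / κ))) := by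
    intro q
    have hfin := finrank_disorder N ((q : ℕ) + 1)
    have hN1 : 1 ≤ (N : ℕ) := N.pos
    have hNle : (N : ℕ) ≤ finrank ℝ (Fin (q + 1) → EuclideanSpace ℝ (Fin N)) := by
      rw [hfin]
      exact Nat.le_mul_of_pos_left _ (Nat.succ_pos _)
    have hNle' : (N : ℝ) ≤ finrank ℝ (Fin (q + 1) → EuclideanSpace ℝ (Fin N)) := by
      exact_mod_cast hNle
    have htail := (hJ.isSubgaussianField q).scaledSup_tail one_pos (hN1.trans hNle)
      (fun u => EventuallyEq.rfl) (isSeparableOn_disorderField q) ht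
    have hκq := tailConst_pos (disorderVariance (q + 1)) 1
    refine (measure_mono (Set.ofPred_subset_ofPred.2 fun ω h => ?_)).trans (htail.trans
      (ENNReal.ofReal_le_ofReal (Real.exp_le_exp.2 (neg_le_neg ?_))))
    · exact (ENNReal.ofReal_le_ofReal (by linarith [hle q])).trans h
    · gcongr
      exact hle q
  calc _ ≤ ∑ q : Fin m, P {ω | ENNReal.ofReal (κ + t) ≤ S q ω} :=
        (measure_mono hsub).trans (measure_biUnion_finset_le _ _)
    _ ≤ ∑ _ : Fin m, ENNReal.ofReal (Real.exp (-((N : ℝ) * t ^ 2 / κ))) :=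
        Finset.sum_le_sum fun q _ => hq q
    _ = _ := by
        rw [Finset.sum_const, nsmul_eq_mul, ENNReal.ofReal_mul (Nat.cast_nonneg _),
          ENNReal.ofReal_natCast, Finset.card_univ, Fintype.card_fin]

end Disorder

/-! ### Lipschitz Gaussian processes -/

section GaussianProcess
variable {Ω : Type*} [MeasurableSpace Ω] {P : Measure Ω} [IsProbabilityMeasure P]

lemma hasSubgaussianMGF_of_hasGaussianLaw {X : Ω → ℝ} (hX : HasGaussianLaw X P)
    (h0 : ∫ ω, X ω ∂P = 0) {v : ℝ≥0} (hv : ∫ ω, X ω ^ 2 ∂P ≤ v) : HasSubgaussianMGF X v P := by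
  have hmap := hX.map_eq_gaussianReal
  rw [h0, variance_of_integral_eq_zero hX.aemeasurable h0] at hmap
  exact hasSubgaussianMGF_mono (hasSubgaussianMGF_of_map_eq_gaussianReal hX.aemeasurable hmap)
    (Real.toNNReal_le_iff_le_coe.2 hv)

lemma isSubgaussianField_of_isGaussianProcess {E : Type*} [NormedAddCommGroup E]
    {X : E → Ω → ℝ} {ρ V L : ℝ}
    (hX : IsGaussianProcess X P) (h0 : ∀ x, ∫ ω, X x ω ∂P = 0) (hV : ∫ ω, X 0 ω ^ 2 ∂P ≤ V)
    (hL : ∀ x ∈ closedBall (0 : E) ρ, ∀ y ∈ closedBall (0 : E) ρ,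
      processDist P X x y ≤ L * ‖x - y‖) :
    IsSubgaussianField P X ρ (V.toNNReal + (L ^ 2).toNNReal) where
  zero := by
    refine hasSubgaussianMGF_of_hasGaussianLaw (hX.hasGaussianLaw_eval 0) (h0 0) ?_
    push_cast
    have := Real.le_coe_toNNReal V
    have := ((L ^ 2).toNNReal).2
    linarith
  sub x y hx hy := by
    refine hasSubgaussianMGF_of_hasGaussianLaw hX.hasGaussianLaw_fun_sub ?_ ?_
    · rw [integral_sub (hX.hasGaussianLaw_eval x).integrable (hX.hasGaussianLaw_eval y).integrable,
        h0, h0, sub_zero]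
    · have h := hL x (mem_closedBall_zero_iff.2 hx) y (mem_closedBall_zero_iff.2 hy)
      simp only [processDist, sq_abs] at h
      have hnn : 0 ≤ ∫ ω, (X x ω - X y ω) ^ 2 ∂P := integral_nonneg fun ω => sq_nonneg _
      have h2 := (Real.sqrt_le_iff.1 h).2
      push_cast
      rw [Real.coe_toNNReal _ (sq_nonneg L)]
      have : (0 : ℝ) ≤ V.toNNReal := (V.toNNReal).2
      nlinarith [mul_nonneg this (sq_nonneg ‖x - y‖)]

end GaussianProcess

end GaussianBound

end

theorem lemmaB1 {Ω : ℕ+ → Type*} [∀ N, MeasurableSpace (Ω N)]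
    (P : (N : ℕ+) → Measure (Ω N)) [∀ N, IsProbabilityMeasure (P N)] :
    -- the general bound for Gaussian processes indexed by balls
    (∀ (X : (N : ℕ+) → EuclideanSpace ℝ (Fin N) → Ω N → ℝ) (ρ : ℝ), 0 < ρ →
      (∀ N, IsGaussianProcess (X N) (P N)) →
      (∀ N x, ∫ ω, X N x ω ∂(P N) = 0) →
      (∃ V : ℝ, ∀ N, ∫ ω, X N 0 ω ^ 2 ∂(P N) ≤ V) →
      (∃ L : ℝ, ∀ N, ∀ x ∈ Metric.closedBall 0 ρ, ∀ y ∈ Metric.closedBall 0 ρ,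
        GaussianBound.processDist (P N) (X N) x y ≤ L * ‖x - y‖) →
      -- a version with continuous paths on the ball exists
      (∀ N : ℕ+, ∃ Y : EuclideanSpace ℝ (Fin N) → Ω N → ℝ, GaussianBound.IsVersion (P N) Y (X N) ∧
        ∀ᵐ ω ∂(P N), ContinuousOn (fun x => Y x ω) (Metric.closedBall 0 ρ)) ∧
      -- moments, for all separable versions
      (∀ k : ℕ, ∃ M : ℝ≥0, ∀ (N : ℕ+) (Y : EuclideanSpace ℝ (Fin N) → Ω N → ℝ),
        GaussianBound.IsVersion (P N) Y (X N) →
        GaussianBound.IsSeparableOn (P N) Y (Metric.closedBall 0 ρ) →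
        AEMeasurable (GaussianBound.supNorm N ρ Y) (P N) ∧
        ∫⁻ ω, GaussianBound.supNorm N ρ Y ω ^ k ∂(P N) ≤ M) ∧
      -- tails, for all separable versions
      (∃ κ : ℝ, 0 < κ ∧ ∀ (N : ℕ+) (Y : EuclideanSpace ℝ (Fin N) → Ω N → ℝ),
        GaussianBound.IsVersion (P N) Y (X N) →
        GaussianBound.IsSeparableOn (P N) Y (Metric.closedBall 0 ρ) →
        ∀ t : ℝ, 0 < t →
          P N {ω | ENNReal.ofReal (κ + t) ≤ GaussianBound.supNorm N ρ Y ω} ≤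
            ENNReal.ofReal (Real.exp (-((N : ℝ) * t ^ 2 / κ))))) ∧
    -- the norm of the disorder
    (∀ (m : ℕ), 1 ≤ m →
      ∀ (J : (N : ℕ+) → (q : Fin m) → Sym (Fin N) (q + 1) → Ω N → ℝ),
      (∀ N, GaussianBound.IsDisorder (P N) N m (J N)) →
      (∀ N, AEMeasurable (GaussianBound.disorderNorm N m (J N)) (P N)) ∧
      (∀ k : ℕ, ∃ M : ℝ≥0, ∀ N, ∫⁻ ω, GaussianBound.disorderNorm N m (J N) ω ^ k ∂(P N) ≤ M) ∧
      (∃ κ : ℝ, 0 < κ ∧ ∀ N, ∀ t : ℝ, 0 < t →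
        P N {ω | ENNReal.ofReal (κ + t) ≤ GaussianBound.disorderNorm N m (J N) ω} ≤
          ENNReal.ofReal (m * Real.exp (-((N : ℝ) * t ^ 2 / κ))))) := by
  refine ⟨fun X ρ hρ hX h0 ⟨V, hV⟩ ⟨L, hL⟩ => ?_, fun m _ J hJ => ?_⟩
  · set v : ℝ≥0 := V.toNNReal + (L ^ 2).toNNReal with hv
    have hfield : ∀ N, GaussianBound.IsSubgaussianField (P N) (X N) ρ v := fun N =>
      GaussianBound.isSubgaussianField_of_isGaussianProcess (hX N) (h0 N) (hV N) (hL N)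
    have hdim : ∀ N : ℕ+, Module.finrank ℝ (EuclideanSpace ℝ (Fin N)) = N := fun N => by simp
    have hd : ∀ N : ℕ+, 1 ≤ Module.finrank ℝ (EuclideanSpace ℝ (Fin N)) := fun N => by
      rw [hdim]; exact N.pos
    have hκ := GaussianBound.tailConst_pos v ρ
    have htail : ∀ (N : ℕ+) (Y : EuclideanSpace ℝ (Fin N) → Ω N → ℝ),
        GaussianBound.IsVersion (P N) Y (X N) →
        GaussianBound.IsSeparableOn (P N) Y (Metric.closedBall 0 ρ) →
        ∀ t : ℝ, 0 < t →
          P N {ω | ENNReal.ofReal (GaussianBound.tailConst v ρ + t) ≤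
            GaussianBound.supNorm N ρ Y ω} ≤
          ENNReal.ofReal (Real.exp (-((N : ℝ) * t ^ 2 / GaussianBound.tailConst v ρ))) := by
      intro N Y hY hYs t ht
      have h := (hfield N).scaledSup_tail hρ (hd N) hY hYs ht
      rw [hdim] at h
      exact h
    refine ⟨fun N => ?_, fun k => ?_, _, hκ, htail⟩
    · obtain ⟨Y, hY, hYc, -⟩ := (hfield N).exists_continuous_version hρ (hd N)
      exact ⟨Y, hY, hYc⟩
    · refine ⟨(GaussianBound.momentBound (GaussianBound.tailConst v ρ) 1 k).toNNReal,
        fun N Y hY hYs => ?_⟩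
      have hmeas : AEMeasurable (GaussianBound.supNorm N ρ Y) (P N) :=
        GaussianBound.aemeasurable_scaledSup _ (hX N).aemeasurable hYs hY
      refine ⟨hmeas, ?_⟩
      rw [ENNReal.coe_toNNReal (GaussianBound.momentBound_ne_top hκ zero_le_one k)]
      refine GaussianBound.lintegral_pow_le_momentBound hκ hmeas (fun t ht => ?_) k
      refine (htail N Y hY hYs t ht).trans (ENNReal.ofReal_le_ofReal ?_)
      rw [one_mul]
      have hN : (1 : ℝ) ≤ N := by exact_mod_cast N.pos
      gcongr
      exact le_mul_of_one_le_left (sq_nonneg t) hN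
  · have hκ := GaussianBound.disorderTailConst_pos m
    refine ⟨fun N => (hJ N).aemeasurable_disorderNorm, fun k => ?_, _, hκ,
      fun N t ht => (hJ N).disorderNorm_tail ht⟩
    refine ⟨(GaussianBound.momentBound (GaussianBound.disorderTailConst m) m k).toNNReal,
      fun N => ?_⟩
    rw [ENNReal.coe_toNNReal (GaussianBound.momentBound_ne_top hκ (Nat.cast_nonneg m) k)]
    refine GaussianBound.lintegral_pow_le_momentBound hκ (hJ N).aemeasurable_disorderNorm
      (fun t ht => ?_) k
    refine ((hJ N).disorderNorm_tail ht).trans (ENNReal.ofReal_le_ofReal ?_)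
    have hN : (1 : ℝ) ≤ N := by exact_mod_cast N.pos
    gcongr
    exact le_mul_of_one_le_left (sq_nonneg t) hN
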